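/- **Setting.** Let $\langle f,g\rangle=\int_{\mathbb R^3} f g\,dx$ (no complex conjugation). Let $\mathcal H=-\Delta+V+\underline c$ on $L^2(\mathbb R^3)$ with $V$ a real Schwartz function and $\underline c>0$, and assume: * $\mathcal H\ge 0$; the eigenvalues of $\mathcal H$, repeated with multiplicity, are $0=\lambda_0<\lambda_1\le\dots\le\lambda_n<\underline c$; $\underline c$ is neither an eigenvalue nor a resonance (there is no nonzero solution of $\Delta u=Vu$ with $|u(x)|\lesssim\langle x\rangle^{-1}$); $\underline c\notin\mathbb N$; * for $j=1,\dots,n$ there is $N_j\in\mathbb N$ with $N_j\lambda_j<\underline c<(N_j+1)\lambda_j$; put $N=\max\{\sup_jN_j,[\underline c]\}$ and $\lambda=(\lambda_0,\dots,\lambda_n)$; * $\lambda\cdot\mu+m\ne\underline c$ for all $\mu\in\mathbb Z^{n+1}$ with $|\mu|=\sum_j|\mu_j|\le 2N+1$ and all $m\in\mathbb Z$ with $|m|\le N$; * if $0<\lambda_{j_1}<\dots<\lambda_{j_k}$, $\mu\in\mathbb Z^k$, $|\mu|\le 4N+2$, $m\in\mathbb Z$, $|m|\le 2N$, then $\mu_1\lambda_{j_1}+\dots+\mu_k\lambda_{j_k}+m=0$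 if and only if $\mu=0$ and $m=0$. Let $R^\pm(w)=(\mathcal H-w\mp i0)^{-1}$ be the boundary values of the resolvent, and $\delta(\mathcal H-w)=\lim_{\varepsilon\to0^+}\frac{\varepsilon}{\pi}\big((\mathcal H-w)^2+\varepsilon^2\big)^{-1}$, as weak limits from Schwartz functions to tempered distributions; they are used only at energies $w>\underline c$. **Normal form.** Let $Z_0(z)=\sum a_{\mu\nu}z^\mu\bar z^\nu$ be a finite sum over pairs of multi-indices $\mu,\nu\in\mathbb N_0^{n+1}$ with $\lambda\cdot(\mu-\nu)=0$ and $|\mu|=|\nu|$, where $\overline{a_{\mu\nu}}=a_{\nu\mu}$. Let $\mathbf M$ be the set of triples $(m,\mu,\nu)\in\mathbb Z\times\mathbb N_0^{n+1}\times\mathbb N_0^{n+1}$ with $\lambda\cdot(\mu-\nu)-m<-\underline c$, $|\mu|=|\nu|-1$, $|m|\le|\mu|\le N$, and $\mathbf M'=\{(m',\mu',\nu'):(-m',\nu',\mu')\in\mathbf M\}$. Let $M\subseteq\mathbf M$ be the set of the minimal elements, that is, of those $(m,\mu,\nu)\in\mathbf M$ such that $(m,\alpha,\beta)\in\mathbf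 M$, $\alpha\le\mu$, $\beta\le\nu$ (componentwise) imply $(\alpha,\beta)=(\mu,\nu)$, and let $M'\subseteq\mathbf M'$ be defined likewise. Let $\Phi_{m\mu\nu}$ be complex-valued Schwartz functions on $\mathbb R^3$, and $\Psi_{m\mu\nu}=\overline{\Phi_{-m\,\nu\mu}}$. For $(m',\mu',\nu')\in M'$ write $R^\pm_{\mu'\nu'm'}=R^\pm(\lambda\cdot(\mu'-\nu')-m')$. **Modified variables.** Let $z=(z_0,\dots,z_n):\mathbb R\to\mathbb C^{n+1}$ be differentiable at $t$ (in particular, $z$ may be the discrete component of a solution of the Hamiltonian system in normal form). Define $\zeta$ by $$z_j=\zeta_j+\sum_{\mathcal M_1}\frac{\nu_je^{i(m+m')t}z^{\mu+\mu'}\bar z^{\nu+\nu'}\langle R^+_{\mu'\nu'm'}\Psi_{m'\mu'\nu'},\Phi_{m\mu\nu}\rangle}{(m+m'-\lambda\cdot(\mu+\mu'-\nu-\nu'))\,\bar z_j}+\sum_{\mathcal M_2}\frac{\nu_je^{i(m-m')t}z^{\mu+\nu'}\bar z^{\nu+\mu'}\langle R^-_{\mu'\nu'm'}\overline{\Psi_{m'\mu'\nu'}},\Psi_{m\mu\nu}\rangle}{(m-m'-\lambda\cdot(\mu+\nu'-\nu-\mu'))\,\bar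 z_j},$$ where $\mathcal M_1$ (resp. $\mathcal M_2$) is the set of the pairs $((m,\mu,\nu),(m',\mu',\nu'))$ in $M\times M'$ (resp. $M'\times M'$) for which the denominator $m+m'-\lambda\cdot(\dots)$ (resp. $m-m'-\lambda\cdot(\dots)$) is nonzero, and where $\nu_j\bar z^{\nu+\beta}/\bar z_j$ is read as a monomial ($0$ if $\nu_j=0$), also below. Let $\mathcal D_j$ be the remainder in the resulting system for $\zeta$, that is, let it be defined by $$\begin{aligned} i\dot\zeta_j-\lambda_j\zeta_j-\partial_{\bar\zeta_j}Z_0(\zeta)-\mathcal D_j=&-\sum_{\substack{(m,\mu,\nu)\in M,\ (-m,\mu',\nu')\in M'\\ \lambda\cdot(\mu+\mu')=\lambda\cdot(\nu+\nu')}}\nu_j\frac{\zeta^{\mu+\mu'}\bar\zeta^{\nu+\nu'}}{\bar\zeta_j}\langle R^+_{\mu'\nu'(-m)}\overline{\Phi_{m\nu'\mu'}},\Phi_{m\mu\nu}\rangle\\&-\sum_{\substack{(m,\mu,\nu)\in M',\ (m,\mu',\nu')\in M'\\ \lambda\cdot(\mu-\nu)=\lambda\cdot(\mu'-\nu')}}\nu_j\frac{\zeta^{\mu+\nu'}\bar\zeta^{\nu+\mu'}}{\bar\zeta_j}\langle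 R^-_{\mu'\nu'm}\overline{\Psi_{m\mu'\nu'}},\Psi_{m\mu\nu}\rangle .\end{aligned}$$ **Claim.** Let $X=\{\lambda\cdot(\beta-\alpha)+m:(m,\alpha,\beta)\in M\}$ and, for $w\in X$, $M_w=\{(m,\alpha,\beta)\in M:\lambda\cdot(\beta-\alpha)+m=w\}$ and $\mathbf\Phi_w=\sum_{(m,\mu,\nu)\in M_w}\zeta^\mu\bar\zeta^\nu\Phi_{m\mu\nu}$. Then $\zeta$ is differentiable at $t$ and, at time $t$, $$\sum_{j=0}^n\tfrac12\,\partial_t|\zeta_j|^2+\pi\sum_{w\in X}\langle\delta(\mathcal H-w)\overline{\mathbf\Phi_w},\mathbf\Phi_w\rangle=\sum_{j=0}^n\operatorname{Im}\big(\mathcal D_j\overline{\zeta_j}\big).$$ -/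

import Mathlib

open MeasureTheory Filter Topology
open scoped SchwartzMap ComplexConjugate

namespace FermiGoldenRule

noncomputable section

/-! ### The Schrödinger operator on `L²(ℝ³)` -/

/-- The space `ℝ³`. -/
abbrev R3 : Type := EuclideanSpace ℝ (Fin 3)

/-- The Hilbert space `L²(ℝ³, ℂ)`. -/
abbrev L2 : Type := Lp ℂ 2 (volume : Measure R3)

/-- The embedding of `L²` into the tempered distributions. -/
def toDist : L2 →ₗ[ℂ] 𝓢'(R3, ℂ) :=
  (Lp.toTemperedDistributionCLM ℂ (volume : Measure R3) 2 : L2 →L[ℂ] 𝓢'(R3, ℂ))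

/-- The distribution `(-Δ + V + c) u` for `u ∈ L²`. The self-adjoint operator `H = -Δ + V + c` of
`L²(ℝ³)` (with domain the Sobolev space of order two) is the restriction of this map to those `u`
for which the result is again in `L²`: `H u = v` means `distH V c u = toDist v`. -/
def distH (V : 𝓢(R3, ℝ)) (c : ℝ) : L2 →ₗ[ℂ] 𝓢'(R3, ℂ) :=
  (-(LineDeriv.laplacianCLM ℂ R3 𝓢'(R3, ℂ))
    + TemperedDistribution.smulLeftCLM ℂ (fun x : R3 => ((V x + c : ℝ) : ℂ)) :
      𝓢'(R3, ℂ) →L[ℂ] 𝓢'(R3, ℂ)).toLinearMap ∘ₗ toDist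

/-- `H u = v`, that is, `u` is in the domain of `H` and is mapped to `v`. -/
def IsHImage (V : 𝓢(R3, ℝ)) (c : ℝ) (u v : L2) : Prop := distH V c u = toDist v

/-- The space of solutions `u` in the domain of `H` of `H u = x u`. -/
def eigenspace (V : 𝓢(R3, ℝ)) (c x : ℝ) : Submodule ℂ L2 :=
  LinearMap.ker (distH V c - (x : ℂ) • toDist)

/-- `B` is the bounded inverse of `H - ζ`. -/
def IsResolvent (V : 𝓢(R3, ℝ)) (c : ℝ) (ζ : ℂ) (B : L2 →L[ℂ] L2) : Prop :=
  ∀ a u : L2, B a = u ↔ IsHImage V c u (a + ζ • u)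

open Classical in
/-- The resolvent `R_H(ζ) = (H - ζ)⁻¹` (and `0` if `ζ` is in the spectrum of `H`). -/
def resolventH (V : 𝓢(R3, ℝ)) (c : ℝ) (ζ : ℂ) : L2 →L[ℂ] L2 :=
  if h : ∃ B, IsResolvent V c ζ B then h.choose else 0

/-- The bilinear pairing `⟨f, g⟩ = ∫ f g` (no complex conjugation). -/
def pairing (f g : L2) : ℂ := ∫ x, f x * g x

/-- A Schwartz function as an element of `L²`. -/
def emb (a : 𝓢(R3, ℂ)) : L2 := a.toLp 2 volume

/-- Complex conjugation of Schwartz functions. -/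
def conjS (a : 𝓢(R3, ℂ)) : 𝓢(R3, ℂ) :=
  SchwartzMap.postcompCLM (𝕜 := ℝ) (Complex.conjCLE : ℂ →L[ℝ] ℂ) a

/-- `⟨R_H(w + i ε) a, b⟩`. -/
def resPair (V : 𝓢(R3, ℝ)) (c w ε : ℝ) (a b : 𝓢(R3, ℂ)) : ℂ :=
  pairing (resolventH V c (w + ε * Complex.I) (emb a)) (emb b)

/-- `⟨(ε / π) ((H - w)² + ε²)⁻¹ a, b⟩`, where `((H - w)² + ε²)⁻¹ = R_H(w + i ε) R_H(w - i ε)`. -/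
def poissonPair (V : 𝓢(R3, ℝ)) (c w ε : ℝ) (a b : 𝓢(R3, ℂ)) : ℂ :=
  (ε / Real.pi : ℝ) * pairing (resolventH V c (w + ε * Complex.I)
    (resolventH V c (w - ε * Complex.I) (emb a))) (emb b)

/-- The limiting absorption principle at the energy `w`: the boundary values `R_H(w ± i 0)` of the
resolvent exist as weak limits, from Schwartz functions to tempered distributions. -/
def HasBoundaryValues (V : 𝓢(R3, ℝ)) (c w : ℝ) : Prop :=
  ∀ a b : 𝓢(R3, ℂ),
    (∃ l, Tendsto (fun ε : ℝ => resPair V c w ε a b) (𝓝[>] 0) (𝓝 l)) ∧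
    (∃ l, Tendsto (fun ε : ℝ => resPair V c w (-ε) a b) (𝓝[>] 0) (𝓝 l))

open Classical in
/-- `⟨R_H⁺(w) a, b⟩`, where `R_H⁺(w) = R_H(w + i 0)`. Here and below the convention is that the
operator is `0` at an energy where the limiting absorption principle fails. (It holds at every
`w > c` that is not an eigenvalue of `H`, the only energies at which these objects are used.) -/
def resPlus (V : 𝓢(R3, ℝ)) (c w : ℝ) (a b : 𝓢(R3, ℂ)) : ℂ :=
  if HasBoundaryValues V c w then limUnder (𝓝[>] (0 : ℝ)) (fun ε => resPair V c w ε a b) else 0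

open Classical in
/-- `⟨R_H⁻(w) a, b⟩`, where `R_H⁻(w) = R_H(w - i 0)`. -/
def resMinus (V : 𝓢(R3, ℝ)) (c w : ℝ) (a b : 𝓢(R3, ℂ)) : ℂ :=
  if HasBoundaryValues V c w then limUnder (𝓝[>] (0 : ℝ)) (fun ε => resPair V c w (-ε) a b) else 0

open Classical in
/-- `⟨δ(H - w) a, b⟩`, where `δ(H - w) = lim_{ε → 0+} (ε / π) ((H - w)² + ε²)⁻¹`. -/
def deltaPair (V : 𝓢(R3, ℝ)) (c w : ℝ) (a b : 𝓢(R3, ℂ)) : ℂ :=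
  if HasBoundaryValues V c w then limUnder (𝓝[>] (0 : ℝ)) (fun ε => poissonPair V c w ε a b) else 0

/-! ### The standing assumptions -/

/-- `N = max {sup_j N_j, [c]}`. -/
def bigN (c : ℝ) {n : ℕ} (Nj : Fin n → ℕ) : ℕ := max (Finset.univ.sup Nj) ⌊c⌋₊

/-- The assumptions on the potential `V`, the constant `c`, the eigenvalues `λ_0, …, λ_n` of
`H = -Δ + V + c`, and the integers `N_1, …, N_n`. -/
structure StandingAssumptions (V : 𝓢(R3, ℝ)) (c : ℝ) {n : ℕ} (lam : Fin (n + 1) → ℝ)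
    (Nj : Fin n → ℕ) : Prop where
  c_pos : 0 < c
  /-- `H ≥ 0`. -/
  nonneg : ∀ u v : L2, IsHImage V c u v → 0 ≤ (inner ℂ u v).re
  lam_zero : lam 0 = 0
  lam_pos : ∀ j : Fin n, 0 < lam j.succ
  lam_mono : Monotone lam
  lam_lt : ∀ j, lam j < c
  /-- `λ_0, …, λ_n` are all the eigenvalues of `H`, repeated according to multiplicity. -/
  eigenvalues : ∀ x : ℝ, Module.rank ℂ (eigenspace V c x) = (Nat.card {j // lam j = x} : ℕ)
  /-- `c` is not a resonance. -/
  no_resonance : ∀ u : R3 → ℂ, ContDiff ℝ 2 u →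
    (∀ x, Laplacian.laplacian u x = (V x : ℂ) * u x) →
    (∃ C : ℝ, ∀ x, ‖u x‖ ≤ C / (1 + ‖x‖)) → u = 0
  c_not_nat : ∀ k : ℕ, c ≠ k
  Nj_spec : ∀ j : Fin n, Nj j * lam j.succ < c ∧ c < (Nj j + 1) * lam j.succ
  nonres_c : ∀ (μ : Fin (n + 1) → ℤ) (m : ℤ), ∑ j, |μ j| ≤ 2 * bigN c Nj + 1 →
    |m| ≤ bigN c Nj → ∑ j, μ j * lam j + m ≠ c
  /-- Non-resonance among distinct positive eigenvalues and the integers. -/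
  nonres : ∀ (k : ℕ) (i : Fin k → Fin (n + 1)), StrictMono (lam ∘ i) → (∀ l, 0 < lam (i l)) →
    ∀ (μ : Fin k → ℤ) (m : ℤ), ∑ l, |μ l| ≤ 4 * bigN c Nj + 2 → |m| ≤ 2 * bigN c Nj →
    (∑ l, μ l * lam (i l) + m = 0 ↔ μ = 0 ∧ m = 0)

/-! ### Multi-indices and monomials -/

/-- Multi-indices with components `0, …, n`. -/
abbrev MI (n : ℕ) : Type := Fin (n + 1) → ℕ

/-- Triples `(m, μ, ν)`. -/
abbrev Idx (n : ℕ) : Type := ℤ × MI n × MI n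

/-- `|μ| = μ_0 + … + μ_n`. -/
def deg {n : ℕ} (μ : MI n) : ℕ := ∑ j, μ j

/-- `λ · (μ - ν)`. -/
def freq {n : ℕ} (lam : Fin (n + 1) → ℝ) (μ ν : MI n) : ℝ := ∑ j, lam j * ((μ j : ℝ) - (ν j : ℝ))

/-- `λ · (μ - ν) - m` for a triple `(m, μ, ν)`. -/
def energy {n : ℕ} (lam : Fin (n + 1) → ℝ) (p : Idx n) : ℝ := freq lam p.2.1 p.2.2 - p.1

/-- `z^μ z̄^ν`. -/
def mono {n : ℕ} (z : Fin (n + 1) → ℂ) (μ ν : MI n) : ℂ :=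
  (∏ j, z j ^ μ j) * ∏ j, conj (z j) ^ ν j

/-- `ν_j z^α z̄^(ν + β) / z̄_j`, as a polynomial in `z` and `z̄`: it is `0` when `ν_j = 0`, and when
`ν_j > 0` the exponent `ν + β` is lowered by one in the component `j`. -/
def monoDiv {n : ℕ} (z : Fin (n + 1) → ℂ) (j : Fin (n + 1)) (α ν β : MI n) : ℂ :=
  (ν j : ℂ) * mono z α (ν + β - Pi.single j 1)

/-- The Wirtinger derivative `∂F / ∂z̄_j = (∂_x F + i ∂_y F) / 2` for `z_j = x + i y`. -/
def dbar {n : ℕ} (F : (Fin (n + 1) → ℂ) → ℂ) (j : Fin (n + 1)) (z : Fin (n + 1) → ℂ) : ℂ :=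
  (1 / 2) * (fderiv ℝ F z (Pi.single j 1) + Complex.I * fderiv ℝ F z (Pi.single j Complex.I))

/-! ### The normal form -/

/-- The data of a function in normal form: `Z = Z_0 + Z_1` with `Z_0 = ∑ a_{μν} z^μ z̄^ν` and
`Z_1 = ∑ e^{itm} z^μ z̄^ν ⟨Φ_{mμν}, f⟩ + ∑ e^{itm} z^μ z̄^ν ⟨Ψ_{mμν}, f̄⟩`.
Of the functions `Φ` and `Ψ`, only those with indices in the finite sets `Mset`, `Mset'` below
are ever used. -/
structure NormalForm {n : ℕ} (lam : Fin (n + 1) → ℝ) where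
  a : (MI n × MI n) →₀ ℂ
  a_resonant : ∀ μ ν, a (μ, ν) ≠ 0 → freq lam μ ν = 0 ∧ deg μ = deg ν
  a_real : ∀ μ ν, conj (a (μ, ν)) = a (ν, μ)
  Φ : Idx n → 𝓢(R3, ℂ)
  Ψ : Idx n → 𝓢(R3, ℂ)
  Ψ_eq : ∀ m μ ν, Ψ (m, μ, ν) = conjS (Φ (-m, ν, μ))

/-- `Z_0(z, z̄)`. -/
def NormalForm.Z0 {n : ℕ} {lam : Fin (n + 1) → ℝ} (Z : NormalForm lam) (z : Fin (n + 1) → ℂ) : ℂ :=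
  Z.a.sum fun p a => a * mono z p.1 p.2

open Classical in
/-- The set `𝐌` of the triples `(m, μ, ν)` with `λ·(μ-ν) - m < -c`, `|μ| = |ν| - 1`, and
`|m| ≤ |μ| ≤ N` (the box only serves to make finiteness evident, see `mem_bigM`). -/
def bigM {n : ℕ} (lam : Fin (n + 1) → ℝ) (c : ℝ) (N : ℕ) : Finset (Idx n) :=
  (Finset.Icc (-(N : ℤ)) N ×ˢ Finset.Iic (fun _ => N) ×ˢ Finset.Iic (fun _ => N + 1)).filter
    fun p => energy lam p < -c ∧ deg p.2.1 + 1 = deg p.2.2 ∧ |p.1| ≤ deg p.2.1 ∧ deg p.2.1 ≤ N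

theorem mem_bigM {n : ℕ} (lam : Fin (n + 1) → ℝ) (c : ℝ) (N : ℕ) (p : Idx n) :
    p ∈ bigM lam c N ↔
      energy lam p < -c ∧ deg p.2.1 + 1 = deg p.2.2 ∧ |p.1| ≤ deg p.2.1 ∧ deg p.2.1 ≤ N := by
  have hle : ∀ (μ : MI n) (j : Fin (n + 1)), μ j ≤ deg μ := fun μ j =>
    Finset.single_le_sum (f := μ) (fun _ _ => Nat.zero_le _) (Finset.mem_univ j)
  rw [bigM, Finset.mem_filter]
  refine ⟨fun h => h.2, fun h => ⟨?_, h⟩⟩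
  obtain ⟨-, h2, h3, h4⟩ := h
  rw [abs_le] at h3
  simp only [Finset.mem_product, Finset.mem_Icc, Finset.mem_Iic, Pi.le_def]
  refine ⟨⟨by omega, by omega⟩, fun j => (hle _ j).trans h4, fun j => (hle _ j).trans (by omega)⟩

/-- `(m, μ, ν) ↦ (-m, ν, μ)`. -/
def flip {n : ℕ} (p : Idx n) : Idx n := (-p.1, p.2.2, p.2.1)

theorem flip_flip {n : ℕ} (p : Idx n) : flip (flip p) = p := by simp [flip]

open Classical in
/-- The set `𝐌'` of the triples `(m', μ', ν')` with `(-m', ν', μ') ∈ 𝐌`. -/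
def bigM' {n : ℕ} (lam : Fin (n + 1) → ℝ) (c : ℝ) (N : ℕ) : Finset (Idx n) :=
  (bigM lam c N).image flip

theorem mem_bigM' {n : ℕ} (lam : Fin (n + 1) → ℝ) (c : ℝ) (N : ℕ) (p : Idx n) :
    p ∈ bigM' lam c N ↔ flip p ∈ bigM lam c N := by
  rw [bigM', Finset.mem_image]
  exact ⟨fun ⟨q, hq, h⟩ => by rwa [← h, flip_flip], fun h => ⟨_, h, flip_flip p⟩⟩

open Classical in
/-- The elements `(m, μ, ν)` of `S` that are minimal: if `(m, α, β) ∈ S`, `α ≤ μ`, and `β ≤ ν`, then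
`(α, β) = (μ, ν)`. -/
def minimalIdx {n : ℕ} (S : Finset (Idx n)) : Finset (Idx n) :=
  S.filter fun p => ∀ α β : MI n, (p.1, α, β) ∈ S → α ≤ p.2.1 → β ≤ p.2.2 → (α, β) = p.2

/-- The set `M`. -/
def Mset {n : ℕ} (lam : Fin (n + 1) → ℝ) (c : ℝ) (N : ℕ) : Finset (Idx n) :=
  minimalIdx (bigM lam c N)

/-- The set `M'`. -/
def Mset' {n : ℕ} (lam : Fin (n + 1) → ℝ) (c : ℝ) (N : ℕ) : Finset (Idx n) :=
  minimalIdx (bigM' lam c N)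

/-- `λ · (β - α) + m` for a triple `(m, α, β)`. -/
def level {n : ℕ} (lam : Fin (n + 1) → ℝ) (p : Idx n) : ℝ := freq lam p.2.2 p.2.1 + p.1

open Classical in
/-- `X = {λ · (β - α) + m : (m, α, β) ∈ M}`. -/
def Xset {n : ℕ} (lam : Fin (n + 1) → ℝ) (c : ℝ) (N : ℕ) : Finset ℝ :=
  (Mset lam c N).image (level lam)

open Classical in
/-- `M_w = {(m, α, β) ∈ M : λ · (β - α) + m = w}`. -/
def Mw {n : ℕ} (lam : Fin (n + 1) → ℝ) (c : ℝ) (N : ℕ) (w : ℝ) : Finset (Idx n) :=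
  (Mset lam c N).filter fun p => level lam p = w

/-- `Φ_w = ∑_{(m, μ, ν) ∈ M_w} ζ^μ ζ̄^ν Φ_{mμν}`. -/
def PhiW {n : ℕ} {lam : Fin (n + 1) → ℝ} (c : ℝ) (N : ℕ) (Z : NormalForm lam)
    (ζ : Fin (n + 1) → ℂ) (w : ℝ) : 𝓢(R3, ℂ) :=
  ∑ p ∈ Mw lam c N w, mono ζ p.2.1 p.2.2 • Z.Φ p

/-! ### The modified discrete variables -/

open Classical in
/-- The sum of the two sums in the definition of the modified variables, where
`p = (m, μ, ν)`, `q = (m', μ', ν')`, and only pairs with a non-zero denominator contribute. -/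
def correction (V : 𝓢(R3, ℝ)) (c : ℝ) {n : ℕ} {lam : Fin (n + 1) → ℝ} (N : ℕ) (Z : NormalForm lam)
    (t : ℝ) (z : Fin (n + 1) → ℂ) (j : Fin (n + 1)) : ℂ :=
  (∑ pq ∈ (Mset lam c N ×ˢ Mset' lam c N).filter
      (fun pq => ((pq.1.1 + pq.2.1 : ℤ) : ℝ)
        - freq lam (pq.1.2.1 + pq.2.2.1) (pq.1.2.2 + pq.2.2.2) ≠ 0),
    Complex.exp (Complex.I * ((pq.1.1 + pq.2.1 : ℤ) : ℂ) * t)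
      * monoDiv z j (pq.1.2.1 + pq.2.2.1) pq.1.2.2 pq.2.2.2
      * resPlus V c (energy lam pq.2) (Z.Ψ pq.2) (Z.Φ pq.1)
      / ((((pq.1.1 + pq.2.1 : ℤ) : ℝ)
        - freq lam (pq.1.2.1 + pq.2.2.1) (pq.1.2.2 + pq.2.2.2) : ℝ) : ℂ))
  + ∑ pq ∈ (Mset' lam c N ×ˢ Mset' lam c N).filter
      (fun pq => ((pq.1.1 - pq.2.1 : ℤ) : ℝ)
        - freq lam (pq.1.2.1 + pq.2.2.2) (pq.1.2.2 + pq.2.2.1) ≠ 0),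
    Complex.exp (Complex.I * ((pq.1.1 - pq.2.1 : ℤ) : ℂ) * t)
      * monoDiv z j (pq.1.2.1 + pq.2.2.2) pq.1.2.2 pq.2.2.1
      * resMinus V c (energy lam pq.2) (conjS (Z.Ψ pq.2)) (Z.Ψ pq.1)
      / ((((pq.1.1 - pq.2.1 : ℤ) : ℝ)
        - freq lam (pq.1.2.1 + pq.2.2.2) (pq.1.2.2 + pq.2.2.1) : ℝ) : ℂ)

/-- The modified discrete variables `ζ`, determined by `z_j = ζ_j + correction_j`. -/
def modifiedVar (V : 𝓢(R3, ℝ)) (c : ℝ) {n : ℕ} {lam : Fin (n + 1) → ℝ} (N : ℕ) (Z : NormalForm lam)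
    (z : ℝ → Fin (n + 1) → ℂ) (t : ℝ) (j : Fin (n + 1)) : ℂ :=
  z t j - correction V c N Z t (z t) j

open Classical in
/-- The resonant terms: the `j`-th right-hand side of the system for `ζ`. -/
def resonantTerms (V : 𝓢(R3, ℝ)) (c : ℝ) {n : ℕ} {lam : Fin (n + 1) → ℝ} (N : ℕ)
    (Z : NormalForm lam) (ζ : Fin (n + 1) → ℂ) (j : Fin (n + 1)) : ℂ :=
  -(∑ pq ∈ (Mset lam c N ×ˢ Mset' lam c N).filter (fun pq => pq.2.1 = -pq.1.1 ∧
        freq lam (pq.1.2.1 + pq.2.2.1) (pq.1.2.2 + pq.2.2.2) = 0),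
      monoDiv ζ j (pq.1.2.1 + pq.2.2.1) pq.1.2.2 pq.2.2.2
        * resPlus V c (energy lam pq.2) (conjS (Z.Φ (pq.1.1, pq.2.2.2, pq.2.2.1))) (Z.Φ pq.1))
  - ∑ pq ∈ (Mset' lam c N ×ˢ Mset' lam c N).filter (fun pq => pq.2.1 = pq.1.1 ∧
        freq lam pq.1.2.1 pq.1.2.2 = freq lam pq.2.2.1 pq.2.2.2),
      monoDiv ζ j (pq.1.2.1 + pq.2.2.2) pq.1.2.2 pq.2.2.1
        * resMinus V c (energy lam pq.2) (conjS (Z.Ψ pq.2)) (Z.Ψ pq.1)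

/-- The remainder `𝒟_j` in the system
`i ∂_t ζ_j - λ_j ζ_j - ∂_{ζ̄_j} Z_0(ζ) - 𝒟_j = resonantTerms_j` for the modified variables. -/
def remainder (V : 𝓢(R3, ℝ)) (c : ℝ) {n : ℕ} {lam : Fin (n + 1) → ℝ} (N : ℕ) (Z : NormalForm lam)
    (ζ : ℝ → Fin (n + 1) → ℂ) (t : ℝ) (j : Fin (n + 1)) : ℂ :=
  Complex.I * deriv (fun s => ζ s j) t - lam j * ζ t j - dbar Z.Z0 j (ζ t)
    - resonantTerms V c N Z (ζ t) j

end

end FermiGoldenRule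

namespace FermiGoldenRule

noncomputable section

/-! The remainder is defined by the equation for `ζ`, so the claim is an algebraic balance of the
mass `∑ |ζ_j|²`: multiply the equation by `conj ζ_j`, sum over `j` and take imaginary parts. The
terms `λ_j |ζ_j|²` are real, and `Z_0` contributes nothing because it is real and invariant under `z
↦ e^{is} z` (`NormalForm.sum_im_dbar_Z0`).

In the resonant terms, flipping the indices in `M'` turns both sums into sums over the same pairs
`(p, q)` in `M`, the first with weight `|ν|` and summand `I(p, q)`, the second with weight `|μ|` and
summand `conj I(p, q)`. Since `|ν| = |μ| + 1` on `M`, exactly `-Im I(p, q)` survives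
(`sum_im_resonantTerms`). By non-resonance the pairs of a given level `w` fill the square `M_w ×
M_w`, so the `I(p, q)` add up to `⟨R⁺(w) conj Φ_w, Φ_w⟩` (`StandingAssumptions.sum_interaction`).

Finally, `H` has real coefficients and is symmetric, hence `R⁻` is the conjugate of `R⁺`, and
Stone's formula identifies the imaginary part of that form with `π ⟨δ(H - w) conj Φ_w, Φ_w⟩`
(`pi_mul_deltaPair_conjS`). -/

/-! ### Complex conjugation -/

/-- Complex conjugation on `L²`. -/
def conjL2 : L2 →L[ℝ] L2 :=
  ContinuousLinearMap.compLpL 2 volume (Complex.conjCLE : ℂ →L[ℝ] ℂ)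

theorem coeFn_conjL2 (u : L2) : conjL2 u =ᵐ[volume] fun x => conj (u x) :=
  ContinuousLinearMap.coeFn_compLpL _ u

theorem conjL2_conjL2 (u : L2) : conjL2 (conjL2 u) = u := by
  apply Lp.ext
  filter_upwards [coeFn_conjL2 (conjL2 u), coeFn_conjL2 u] with x h1 h2
  simp [h1, h2]

theorem conjL2_smul (k : ℂ) (u : L2) : conjL2 (k • u) = conj k • conjL2 u := by
  apply Lp.ext
  filter_upwards [coeFn_conjL2 (k • u), coeFn_conjL2 u, Lp.coeFn_smul k u,
    Lp.coeFn_smul (conj k) (conjL2 u)] with x h1 h2 h3 h4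
  simp [h1, h2, h3, h4]

@[simp]
theorem conjS_apply (a : 𝓢(R3, ℂ)) (x : R3) : conjS a x = conj (a x) := rfl

@[simp]
theorem conjS_conjS (a : 𝓢(R3, ℂ)) : conjS (conjS a) = a := by
  ext x; simp

theorem coeFn_emb (a : 𝓢(R3, ℂ)) : emb a =ᵐ[volume] a := a.coeFn_toLp 2 volume

theorem emb_conjS (a : 𝓢(R3, ℂ)) : emb (conjS a) = conjL2 (emb a) := by
  apply Lp.ext
  filter_upwards [coeFn_emb (conjS a), coeFn_emb a, coeFn_conjL2 (emb a)] with x h1 h2 h3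
  simp [h1, h2, h3]

theorem pairing_eq_inner (f g : L2) : pairing f g = inner ℂ (conjL2 f) g := by
  rw [MeasureTheory.L2.inner_def, pairing]
  refine integral_congr_ae ?_
  filter_upwards [coeFn_conjL2 f] with x h
  simp [h, mul_comm]

theorem pairing_conjL2 (f g : L2) : pairing (conjL2 f) (conjL2 g) = conj (pairing f g) := by
  rw [pairing, pairing, ← integral_conj]
  refine integral_congr_ae ?_
  filter_upwards [coeFn_conjL2 f, coeFn_conjL2 g] with x h h'
  simp [h, h']

theorem pairing_comm (f g : L2) : pairing f g = pairing g f := by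
  simp only [pairing, mul_comm]

theorem toDist_apply (u : L2) (g : 𝓢(R3, ℂ)) : toDist u g = ∫ x, g x * u x := by
  change MeasureTheory.Lp.toTemperedDistribution u g = _
  simp [Lp.toTemperedDistribution_apply]

theorem toDist_conjL2 (u : L2) (g : 𝓢(R3, ℂ)) :
    toDist (conjL2 u) g = conj (toDist u (conjS g)) := by
  rw [toDist_apply, toDist_apply, ← integral_conj]
  refine integral_congr_ae ?_
  filter_upwards [coeFn_conjL2 u] with x h
  simp [h]

open Laplacian LineDeriv in
theorem laplacian_conjS (g : 𝓢(R3, ℂ)) : Δ (conjS g) = conjS (Δ g) := by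
  have hd : ∀ (m : R3) (f : 𝓢(R3, ℂ)), ∂_{m} (conjS f) = conjS (∂_{m} f) := by
    intro m f
    ext x
    rw [conjS_apply, SchwartzMap.lineDerivOp_apply_eq_fderiv,
      SchwartzMap.lineDerivOp_apply_eq_fderiv]
    have : (conjS f : R3 → ℂ) = Complex.conjCLE ∘ f := by ext x; simp
    rw [this, ContinuousLinearEquiv.comp_fderiv]
    simp
  have hs : conjS (Δ g) = ∑ i, conjS (∂_{stdOrthonormalBasis ℝ R3 i}
      (∂_{stdOrthonormalBasis ℝ R3 i} g)) := by
    rw [SchwartzMap.laplacian_eq_sum (stdOrthonormalBasis ℝ R3) g]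
    simp [conjS, map_sum]
  rw [hs, SchwartzMap.laplacian_eq_sum (stdOrthonormalBasis ℝ R3)]
  simp only [hd]

/-! ### The Schrödinger operator -/

/-- The bounded multiplier `V + c`. -/
def multiplier (V : 𝓢(R3, ℝ)) (c : ℝ) (x : R3) : ℂ := ((V x + c : ℝ) : ℂ)

theorem multiplier_hasTemperateGrowth (V : 𝓢(R3, ℝ)) (c : ℝ) :
    (multiplier V c).HasTemperateGrowth := by
  have hV : Function.HasTemperateGrowth (V : R3 → ℝ) := V.hasTemperateGrowth
  unfold multiplier
  fun_prop

open Laplacian in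
theorem distH_apply (V : 𝓢(R3, ℝ)) (c : ℝ) (u : L2) (g : 𝓢(R3, ℂ)) :
    distH V c u g =
      -toDist u (Δ g) + toDist u (SchwartzMap.smulLeftCLM ℂ (multiplier V c) g) := by
  have : multiplier V c = fun x => (V x : ℂ) + c := by ext x; simp [multiplier]
  rw [this]
  simp [distH]

theorem conjS_smulLeftCLM (V : 𝓢(R3, ℝ)) (c : ℝ) (g : 𝓢(R3, ℂ)) :
    conjS (SchwartzMap.smulLeftCLM ℂ (multiplier V c) g) =
      SchwartzMap.smulLeftCLM ℂ (multiplier V c) (conjS g) := by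
  ext x
  simp [SchwartzMap.smulLeftCLM_apply_apply (multiplier_hasTemperateGrowth V c), multiplier]

/-- The coefficients of `H` are real, so conjugation can be moved onto the test function and past
`Δ` and `V + c`. -/
theorem IsHImage.conjL2 {V : 𝓢(R3, ℝ)} {c : ℝ} {u v : L2} (h : IsHImage V c u v) :
    IsHImage V c (conjL2 u) (conjL2 v) := by
  unfold IsHImage at *
  ext g
  rw [distH_apply, toDist_conjL2, toDist_conjL2, toDist_conjL2, ← h, distH_apply,
    laplacian_conjS, conjS_smulLeftCLM]
  simp

theorem memLp_multiplier (V : 𝓢(R3, ℝ)) (c : ℝ) : MemLp (multiplier V c) ⊤ volume := by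
  have h1 : MemLp (fun x => (V x : ℂ)) ⊤ (volume : Measure R3) := (V.memLp ⊤ volume).ofReal
  have h2 : MemLp (fun _ : R3 => (c : ℂ)) ⊤ (volume : Measure R3) := memLp_top_const _
  have := h1.add h2
  convert this using 1
  ext x
  simp [multiplier]

/-- Multiplication by `V + c` on `L²`. -/
def mulL2 (V : 𝓢(R3, ℝ)) (c : ℝ) (u : L2) : L2 :=
  ((memLp_multiplier V c).toLp _) • u

theorem coeFn_mulL2 (V : 𝓢(R3, ℝ)) (c : ℝ) (u : L2) :
    mulL2 V c u =ᵐ[volume] fun x => multiplier V c x * u x := by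
  filter_upwards [Lp.coeFn_lpSMul (r := 2) ((memLp_multiplier V c).toLp _) u,
    (memLp_multiplier V c).coeFn_toLp] with x h1 h2
  rw [mulL2, h1, Pi.smul_apply', h2, smul_eq_mul]

theorem toDist_mulL2 (V : 𝓢(R3, ℝ)) (c : ℝ) (u : L2) (g : 𝓢(R3, ℂ)) :
    toDist (mulL2 V c u) g = toDist u (SchwartzMap.smulLeftCLM ℂ (multiplier V c) g) := by
  rw [toDist_apply, toDist_apply]
  refine integral_congr_ae ?_
  filter_upwards [coeFn_mulL2 V c u] with x h
  simp only [h, SchwartzMap.smulLeftCLM_apply_apply (multiplier_hasTemperateGrowth V c), smul_eq_mul]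
  ring

theorem inner_mulL2 (V : 𝓢(R3, ℝ)) (c : ℝ) (u v : L2) :
    inner ℂ (mulL2 V c u) v = inner ℂ u (mulL2 V c v) := by
  rw [MeasureTheory.L2.inner_def, MeasureTheory.L2.inner_def]
  refine integral_congr_ae ?_
  filter_upwards [coeFn_mulL2 V c u, coeFn_mulL2 V c v] with x h h'
  simp only [h, h', RCLike.inner_apply, map_mul, multiplier, Complex.conj_ofReal]
  ring

open Laplacian in
/-- An `L²` function with `L²` Laplacian satisfies `𝓕 (Δ u) = -4 π² |ξ|² 𝓕 u` almost everywhere. -/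
theorem fourier_ae_eq_of_laplacian {u f : L2} (h : Δ (toDist u) = toDist f) :
    (FourierTransform.fourier f : L2) =ᵐ[volume]
      fun ξ => ((-(2 * Real.pi) ^ 2 * ‖ξ‖ ^ 2 : ℝ) : ℂ) * (FourierTransform.fourier u : L2) ξ := by
  have hF : ∀ w : L2, FourierTransform.fourier (toDist w) = toDist (FourierTransform.fourier w) :=
    fun w => Lp.fourier_toTemperedDistribution_eq w
  have h1 := congrArg FourierTransform.fourier h
  rw [hF, TemperedDistribution.laplacian_eq_fourierMultiplierCLM] at h1
  rw [TemperedDistribution.fourierMultiplierCLM_apply] at h1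
  rw [← Complex.coe_smul, FourierTransform.fourier_smul, FourierTransform.fourier_fourierInv_eq,
    hF] at h1
  set F := (FourierTransform.fourier f : L2)
  set U := (FourierTransform.fourier u : L2)
  have hU : LocallyIntegrable U volume := (Lp.memLp U).locallyIntegrable (by norm_num)
  have hFl : LocallyIntegrable F volume := (Lp.memLp F).locallyIntegrable (by norm_num)
  have hmU : LocallyIntegrable
      (fun ξ : R3 => ((-(2 * Real.pi) ^ 2 * ‖ξ‖ ^ 2 : ℝ) : ℂ) * U ξ) volume := by
    rw [← locallyIntegrableOn_univ] at hU ⊢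
    refine hU.continuousOn_mul (g := fun ξ : R3 => ((-(2 * Real.pi) ^ 2 * ‖ξ‖ ^ 2 : ℝ) : ℂ)) ?_ ?_
    · exact Continuous.continuousOn (by fun_prop)
    · exact isClosed_univ.isLocallyClosed
  -- Both sides are locally integrable, so equality as distributions, tested on real bump functions,
  -- gives equality almost everywhere.
  refine ae_eq_of_integral_contDiff_smul_eq hFl hmU ?_
  intro g g_smooth g_cpt
  have hg₁ : HasCompactSupport (Complex.ofRealCLM ∘ g) := g_cpt.comp_left rfl
  have hg₂ : ContDiff ℝ (⊤ : ℕ∞) (Complex.ofRealCLM ∘ g) := by fun_prop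
  have h2 := congrArg (fun T : 𝓢'(R3, ℂ) => T (hg₁.toSchwartzMap hg₂)) h1
  have hgrow : Function.HasTemperateGrowth (fun x : R3 => Complex.ofReal (‖x‖ ^ 2)) := by
    fun_prop
  change _ = toDist F _ at h2
  rw [toDist_apply] at h2
  simp only [Complex.real_smul]
  simp only [HasCompactSupport.toSchwartzMap_toFun, Function.comp_apply, Complex.ofRealCLM_apply] at h2
  rw [← h2]
  have hsmul : ∀ (r : ℂ) (T : 𝓢'(R3, ℂ)) (φ : 𝓢(R3, ℂ)), (r • T) φ = r * T φ :=
    fun _ _ _ => rfl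
  rw [hsmul, TemperedDistribution.smulLeftCLM_apply_apply, toDist_apply, ← integral_const_mul]
  refine integral_congr_ae (Eventually.of_forall fun x => ?_)
  simp only [SchwartzMap.smulLeftCLM_apply_apply hgrow, smul_eq_mul,
    HasCompactSupport.toSchwartzMap_toFun, Function.comp_apply, Complex.ofRealCLM_apply]
  push_cast
  ring

-- By Plancherel, `Δ` becomes multiplication by a real symbol; no integration by parts is needed.
open Laplacian in
theorem inner_laplacian_comm {u f u' f' : L2} (h : Δ (toDist u) = toDist f)
    (h' : Δ (toDist u') = toDist f') : inner ℂ f u' = inner ℂ u f' := by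
  rw [← Lp.inner_fourier_eq f, ← Lp.inner_fourier_eq u, MeasureTheory.L2.inner_def,
    MeasureTheory.L2.inner_def]
  refine integral_congr_ae ?_
  filter_upwards [fourier_ae_eq_of_laplacian h, fourier_ae_eq_of_laplacian h'] with x h1 h2
  simp only [h1, h2, RCLike.inner_apply, map_mul, Complex.conj_ofReal]
  ring

-- As `V + c` is bounded, membership in the domain of `H` forces `Δ u` to be in `L²`, which reduces
-- the symmetry of `H` to that of `Δ`.
open Laplacian in
theorem IsHImage.laplacian_eq {V : 𝓢(R3, ℝ)} {c : ℝ} {u v : L2} (h : IsHImage V c u v) :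
    Δ (toDist u) = toDist (mulL2 V c u - v) := by
  unfold IsHImage at h
  rw [map_sub, ← h]
  ext g
  change _ = toDist (mulL2 V c u) g - distH V c u g
  rw [toDist_mulL2, distH_apply, TemperedDistribution.laplacian_apply_apply]
  ring

/-- `H` is symmetric on its domain. -/
theorem IsHImage.inner_comm {V : 𝓢(R3, ℝ)} {c : ℝ} {u v u' v' : L2} (h : IsHImage V c u v)
    (h' : IsHImage V c u' v') : inner ℂ v u' = inner ℂ u v' := by
  have := inner_laplacian_comm h.laplacian_eq h'.laplacian_eq
  rw [inner_sub_left, inner_sub_right, inner_mulL2] at this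
  exact sub_right_injective this

/-! ### The resolvent -/

theorem IsResolvent.unique {V : 𝓢(R3, ℝ)} {c : ℝ} {ζ : ℂ} {B B' : L2 →L[ℂ] L2}
    (h : IsResolvent V c ζ B) (h' : IsResolvent V c ζ B') : B = B' := by
  ext1 a
  exact (h a _).mpr ((h' a _).mp rfl)

theorem IsResolvent.resolventH_eq {V : 𝓢(R3, ℝ)} {c : ℝ} {ζ : ℂ} {B : L2 →L[ℂ] L2}
    (h : IsResolvent V c ζ B) : resolventH V c ζ = B := by
  have hex : ∃ B, IsResolvent V c ζ B := ⟨B, h⟩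
  rw [resolventH, dif_pos hex]
  exact hex.choose_spec.unique h

/-- The conjugate `a ↦ conj (B (conj a))` of an operator. -/
def conjOp (B : L2 →L[ℂ] L2) : L2 →L[ℂ] L2 where
  toFun a := conjL2 (B (conjL2 a))
  map_add' a b := by simp
  map_smul' k a := by simp [conjL2_smul]
  cont := conjL2.continuous.comp (B.continuous.comp conjL2.continuous)

theorem conjOp_apply (B : L2 →L[ℂ] L2) (a : L2) : conjOp B a = conjL2 (B (conjL2 a)) := rfl

theorem IsResolvent.conjOp {V : 𝓢(R3, ℝ)} {c : ℝ} {ζ : ℂ} {B : L2 →L[ℂ] L2}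
    (h : IsResolvent V c ζ B) : IsResolvent V c (conj ζ) (conjOp B) := by
  intro a u
  rw [conjOp_apply]
  have hiff : FermiGoldenRule.conjL2 (B (FermiGoldenRule.conjL2 a)) = u ↔
      B (FermiGoldenRule.conjL2 a) = FermiGoldenRule.conjL2 u := by
    constructor
    · rintro rfl; rw [conjL2_conjL2]
    · intro h; rw [h, conjL2_conjL2]
  rw [hiff, h]
  constructor
  · intro h
    simpa [conjL2_conjL2, conjL2_smul] using h.conjL2
  · intro h
    simpa [conjL2_conjL2, conjL2_smul] using h.conjL2

theorem resolventH_conj (V : 𝓢(R3, ℝ)) (c : ℝ) (ζ : ℂ) :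
    resolventH V c (conj ζ) = conjOp (resolventH V c ζ) := by
  by_cases h : ∃ B, IsResolvent V c ζ B
  · obtain ⟨B, hB⟩ := h
    rw [hB.resolventH_eq, hB.conjOp.resolventH_eq]
  · have h' : ¬ ∃ B, IsResolvent V c (conj ζ) B := by
      rintro ⟨B, hB⟩
      exact h ⟨_, by simpa using hB.conjOp⟩
    rw [resolventH, resolventH, dif_neg h, dif_neg h']
    ext1 a
    simp [conjOp_apply]

/-- `R(conj ζ)` is the adjoint of `R(ζ)`. -/
theorem inner_resolventH_conj (V : 𝓢(R3, ℝ)) (c : ℝ) (ζ : ℂ) (a b : L2) :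
    inner ℂ (resolventH V c (conj ζ) a) b = inner ℂ a (resolventH V c ζ b) := by
  by_cases h : ∃ B, IsResolvent V c ζ B
  · obtain ⟨B, hB⟩ := h
    rw [hB.resolventH_eq, hB.conjOp.resolventH_eq]
    -- Symmetry of `H` on the two resolvent vectors; the terms in `ζ` cancel because the left slot
    -- is conjugate-linear.
    have := ((hB.conjOp a _).mp rfl).inner_comm ((hB b _).mp rfl)
    simpa [inner_add_left, inner_add_right, inner_smul_left, inner_smul_right] using this.symm
  · rw [resolventH_conj, resolventH, dif_neg h]
    simp [conjOp_apply]

/-- The resolvent is symmetric for the bilinear pairing. -/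
theorem pairing_resolventH (V : 𝓢(R3, ℝ)) (c : ℝ) (ζ : ℂ) (a b : L2) :
    pairing (resolventH V c ζ a) b = pairing (resolventH V c ζ b) a := by
  rw [pairing_comm _ a, pairing_eq_inner, pairing_eq_inner, ← inner_resolventH_conj,
    resolventH_conj, conjOp_apply, conjL2_conjL2]

/-- The resolvent identity at a pair of conjugate points. -/
theorem resolventH_sub_conj (V : 𝓢(R3, ℝ)) (c : ℝ) (ζ : ℂ) (a : L2) :
    resolventH V c ζ a - resolventH V c (conj ζ) a =
      (ζ - conj ζ) • resolventH V c ζ (resolventH V c (conj ζ) a) := by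
  by_cases h : ∃ B, IsResolvent V c ζ B
  · obtain ⟨B, hB⟩ := h
    rw [hB.resolventH_eq, hB.conjOp.resolventH_eq]
    have h1 := (hB.conjOp a _).mp rfl
    -- The argument of `B` is `H - ζ` applied to `R(conj ζ) a`.
    have h2 : B (a + (conj ζ - ζ) • conjOp B a) = conjOp B a := by
      rw [hB]
      convert h1 using 1
      module
    rw [map_add, map_smul] at h2
    rw [eq_sub_of_add_eq h2]
    module
  · rw [resolventH_conj, resolventH, dif_neg h]
    simp [conjOp_apply]

/-! ### Boundary values -/

theorem resPair_eq (V : 𝓢(R3, ℝ)) (c w ε : ℝ) (a b : 𝓢(R3, ℂ)) :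
    resPair V c w (-ε) a b =
      pairing (resolventH V c (conj ((w : ℂ) + ε * Complex.I)) (emb a)) (emb b) := by
  simp [resPair]

theorem resPair_conj (V : 𝓢(R3, ℝ)) (c w ε : ℝ) (a b : 𝓢(R3, ℂ)) :
    resPair V c w (-ε) (conjS a) (conjS b) = conj (resPair V c w ε a b) := by
  rw [resPair_eq, resolventH_conj, conjOp_apply, emb_conjS, emb_conjS, conjL2_conjL2,
    pairing_conjL2, resPair]

theorem resPair_comm (V : 𝓢(R3, ℝ)) (c w ε : ℝ) (a b : 𝓢(R3, ℂ)) :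
    resPair V c w ε a b = resPair V c w ε b a :=
  pairing_resolventH V c _ _ _

theorem pairing_sub_left (f g k : L2) : pairing (f - g) k = pairing f k - pairing g k := by
  simp [pairing_eq_inner, inner_sub_left]

theorem pairing_smul_left (r : ℂ) (f k : L2) : pairing (r • f) k = r * pairing f k := by
  simp [pairing_eq_inner, inner_smul_left, conjL2_smul]

/-- The resolvent identity at `w ± iε`, where `ζ - conj ζ = 2iε`. -/
theorem pi_mul_poissonPair (V : 𝓢(R3, ℝ)) (c w ε : ℝ) (a b : 𝓢(R3, ℂ)) :
    Real.pi * poissonPair V c w ε a b =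
      (resPair V c w ε a b - resPair V c w (-ε) a b) / (2 * Complex.I) := by
  rw [resPair_eq, resPair, ← pairing_sub_left, resolventH_sub_conj, pairing_smul_left,
    Complex.sub_conj, poissonPair]
  have : conj ((w : ℂ) + ε * Complex.I) = w - ε * Complex.I := by
    simp [sub_eq_add_neg]
  rw [this]
  have hpi : (Real.pi : ℂ) ≠ 0 := by exact_mod_cast Real.pi_ne_zero
  have hI := Complex.I_ne_zero
  push_cast
  field_simp
  simp [mul_comm]

theorem tendsto_resPlus {V : 𝓢(R3, ℝ)} {c w : ℝ} (h : HasBoundaryValues V c w) (a b : 𝓢(R3, ℂ)) :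
    Tendsto (fun ε : ℝ => resPair V c w ε a b) (𝓝[>] 0) (𝓝 (resPlus V c w a b)) := by
  rw [resPlus, if_pos h]
  exact tendsto_nhds_limUnder (h a b).1

theorem tendsto_resMinus {V : 𝓢(R3, ℝ)} {c w : ℝ} (h : HasBoundaryValues V c w) (a b : 𝓢(R3, ℂ)) :
    Tendsto (fun ε : ℝ => resPair V c w (-ε) a b) (𝓝[>] 0) (𝓝 (resMinus V c w a b)) := by
  rw [resMinus, if_pos h]
  exact tendsto_nhds_limUnder (h a b).2

/-- Conjugation exchanges `w + iε` and `w - iε`; where limiting absorption fails, both sides are `0`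
by convention. -/
theorem resMinus_conjS (V : 𝓢(R3, ℝ)) (c w : ℝ) (a b : 𝓢(R3, ℂ)) :
    resMinus V c w (conjS a) (conjS b) = conj (resPlus V c w a b) := by
  by_cases h : HasBoundaryValues V c w
  · refine tendsto_nhds_unique (tendsto_resMinus h _ _) ?_
    simp only [resPair_conj]
    exact (Complex.continuous_conj.tendsto _).comp (tendsto_resPlus h a b)
  · simp [resMinus, resPlus, h]

theorem resMinus_comm (V : 𝓢(R3, ℝ)) (c w : ℝ) (a b : 𝓢(R3, ℂ)) :
    resMinus V c w a b = resMinus V c w b a := by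
  simp only [resMinus, resPair_comm V c w _ a b]

/-- Stone's formula, for the boundary values of the resolvent. -/
theorem pi_mul_deltaPair (V : 𝓢(R3, ℝ)) (c w : ℝ) (a b : 𝓢(R3, ℂ)) :
    Real.pi * deltaPair V c w a b =
      (resPlus V c w a b - resMinus V c w a b) / (2 * Complex.I) := by
  by_cases h : HasBoundaryValues V c w
  · have hpi : (Real.pi : ℂ) ≠ 0 := by exact_mod_cast Real.pi_ne_zero
    -- The limit defining `δ(H - w)` exists because the two boundary values do.
    have h1 : Tendsto (fun ε : ℝ => poissonPair V c w ε a b) (𝓝[>] 0)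
        (𝓝 ((Real.pi : ℂ)⁻¹ *
          ((resPlus V c w a b - resMinus V c w a b) / (2 * Complex.I)))) := by
      have h2 := (((tendsto_resPlus h a b).sub (tendsto_resMinus h a b)).div_const
        (2 * Complex.I)).const_mul ((Real.pi : ℂ)⁻¹)
      refine h2.congr fun ε => ?_
      rw [← pi_mul_poissonPair, inv_mul_cancel_left₀ hpi]
    rw [deltaPair, if_pos h, h1.limUnder_eq, mul_inv_cancel_left₀ hpi]
  · simp [resMinus, resPlus, deltaPair, h]

/-- On the pair `(conj a, a)`, conjugating and then using the symmetry of the bilinear form shows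
that the `R⁻` value is the conjugate of the `R⁺` value. -/
theorem pi_mul_deltaPair_conjS (V : 𝓢(R3, ℝ)) (c w : ℝ) (a : 𝓢(R3, ℂ)) :
    Real.pi * deltaPair V c w (conjS a) a = ((resPlus V c w (conjS a) a).im : ℂ) := by
  have h : resMinus V c w (conjS a) a = conj (resPlus V c w (conjS a) a) := by
    rw [← resMinus_conjS, conjS_conjS, resMinus_comm]
  rw [pi_mul_deltaPair, h, Complex.sub_conj]
  have hI := Complex.I_ne_zero
  push_cast
  field_simp

theorem emb_sum_smul {ι : Type*} (s : Finset ι) (k : ι → ℂ) (a : ι → 𝓢(R3, ℂ)) :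
    emb (∑ i ∈ s, k i • a i) = ∑ i ∈ s, k i • emb (a i) := by
  have : ∀ a, emb a = SchwartzMap.toLpCLM ℂ ℂ 2 (volume : Measure R3) a := fun _ => rfl
  simp only [this, map_sum, map_smul]

theorem resPair_sum_sum {ι κ : Type*} (V : 𝓢(R3, ℝ)) (c w ε : ℝ) (s : Finset ι) (s' : Finset κ)
    (k : ι → ℂ) (l : κ → ℂ) (a : ι → 𝓢(R3, ℂ)) (b : κ → 𝓢(R3, ℂ)) :
    resPair V c w ε (∑ i ∈ s, k i • a i) (∑ j ∈ s', l j • b j) =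
      ∑ i ∈ s, ∑ j ∈ s', k i * l j * resPair V c w ε (a i) (b j) := by
  simp only [resPair, emb_sum_smul, map_sum, map_smul, pairing_eq_inner, conjL2_smul, sum_inner,
    inner_sum, inner_smul_left, inner_smul_right, Complex.conj_conj]
  simp only [Finset.mul_sum]
  rw [Finset.sum_comm]
  refine Finset.sum_congr rfl fun i _ => ?_
  refine Finset.sum_congr rfl fun j _ => ?_
  ring

theorem resPlus_sum_sum {ι κ : Type*} (V : 𝓢(R3, ℝ)) (c w : ℝ) (s : Finset ι) (s' : Finset κ)
    (k : ι → ℂ) (l : κ → ℂ) (a : ι → 𝓢(R3, ℂ)) (b : κ → 𝓢(R3, ℂ)) :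
    resPlus V c w (∑ i ∈ s, k i • a i) (∑ j ∈ s', l j • b j) =
      ∑ i ∈ s, ∑ j ∈ s', k i * l j * resPlus V c w (a i) (b j) := by
  by_cases h : HasBoundaryValues V c w
  · refine tendsto_nhds_unique (tendsto_resPlus h _ _) ?_
    simp only [resPair_sum_sum]
    exact tendsto_finsetSum _ fun i _ => tendsto_finsetSum _ fun j _ =>
      (tendsto_resPlus h _ _).const_mul _
  · simp [resPlus, h]

theorem conjS_sum_smul {ι : Type*} (s : Finset ι) (k : ι → ℂ) (a : ι → 𝓢(R3, ℂ)) :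
    conjS (∑ i ∈ s, k i • a i) = ∑ i ∈ s, conj (k i) • conjS (a i) := by
  ext x
  simp

/-! ### Non-resonance -/

/-- Grouping the eigenvalues according to their value, the non-resonance assumption extends to
combinations of all eigenvalues. -/
theorem StandingAssumptions.eq_zero_of_resonance {V : 𝓢(R3, ℝ)} {c : ℝ} {n : ℕ}
    {lam : Fin (n + 1) → ℝ} {Nj : Fin n → ℕ} (h : StandingAssumptions V c lam Nj)
    (κ : Fin (n + 1) → ℤ) (m : ℤ) (hκ : ∑ j, |κ j| ≤ 4 * bigN c Nj + 2)
    (hm : |m| ≤ 2 * bigN c Nj) (hsum : ∑ j, κ j * lam j + m = 0) : m = 0 := by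
  classical
  have hnonneg : ∀ j, 0 ≤ lam j := fun j => by
    rw [← h.lam_zero]; exact h.lam_mono (Fin.zero_le j)
  -- `S` holds the distinct positive eigenvalues and `e` lists them increasingly, as `nonres`
  -- requires. The coefficient attached to a value is the sum of `κ` over its fibre.
  set S : Finset ℝ := (Finset.univ.image lam).filter (0 < ·) with hS
  set e := S.orderEmbOfFin rfl with he
  have heS : ∀ l, e l ∈ S := fun l => S.orderEmbOfFin_mem rfl l
  have hex : ∀ l, ∃ j, lam j = e l := fun l => by
    have := heS l
    simp only [hS, Finset.mem_filter, Finset.mem_image, Finset.mem_univ, true_and] at this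
    exact this.1
  choose i hi using hex
  have hpos : ∀ l, 0 < lam (i l) := fun l => by
    rw [hi]; exact (Finset.mem_filter.mp (heS l)).2
  have hmono : StrictMono (lam ∘ i) := by
    intro l l' hl
    simpa [hi] using hl
  have hreindex : ∀ {β : Type} [AddCommMonoid β] (f : ℝ → β), ∑ l, f (e l) = ∑ x ∈ S, f x := by
    intro β _ f
    have himage : Finset.univ.image e = S := S.image_orderEmbOfFin_univ rfl
    calc ∑ l, f (e l) = ∑ x ∈ Finset.univ.image e, f x :=
          (Finset.sum_image fun x _ y _ hxy => e.injective hxy).symm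
      _ = ∑ x ∈ S, f x := by rw [himage]
  have hfiber : ∀ {β : Type} [AddCommMonoid β] (g : Fin (n + 1) → β),
      ∑ x ∈ S, ∑ j with lam j = x, g j = ∑ j with 0 < lam j, g j := by
    intro β _ g
    rw [← Finset.sum_fiberwise_of_maps_to (s := Finset.univ.filter fun j => 0 < lam j) (t := S)
      (g := lam) (by intro j hj; simpa [hS] using hj)]
    refine Finset.sum_congr rfl fun x hx => Finset.sum_congr ?_ fun _ _ => rfl
    ext j
    have hx0 : 0 < x := (Finset.mem_filter.mp hx).2
    simp only [Finset.mem_filter, Finset.mem_univ, true_and]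
    exact ⟨fun hj => ⟨hj ▸ hx0, hj⟩, fun hj => hj.2⟩
  refine ((h.nonres _ i hmono hpos (fun l => ∑ j with lam j = e l, κ j) m ?_ hm).mp ?_).2
  · refine le_trans ?_ hκ
    rw [hreindex fun x => |∑ j with lam j = x, κ j|]
    calc ∑ x ∈ S, |∑ j with lam j = x, κ j| ≤ ∑ x ∈ S, ∑ j with lam j = x, |κ j| :=
          Finset.sum_le_sum fun x _ => Finset.abs_sum_le_sum_abs _ _
      _ = ∑ j with 0 < lam j, |κ j| := hfiber _
      _ ≤ ∑ j, |κ j| := Finset.sum_le_sum_of_subset_of_nonneg (Finset.filter_subset _ _)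
          fun _ _ _ => abs_nonneg _
  · rw [← hsum]
    congr 1
    calc ∑ l, ((∑ j with lam j = e l, κ j : ℤ) : ℝ) * lam (i l)
        = ∑ l, ∑ j with lam j = e l, (κ j : ℝ) * lam j := by
          refine Finset.sum_congr rfl fun l _ => ?_
          rw [hi]
          push_cast
          rw [Finset.sum_mul]
          refine Finset.sum_congr rfl fun j hj => ?_
          rw [(Finset.mem_filter.mp hj).2]
      _ = ∑ j with 0 < lam j, (κ j : ℝ) * lam j := by
          rw [hreindex fun x => ∑ j with lam j = x, (κ j : ℝ) * lam j, hfiber]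
      _ = ∑ j, (κ j : ℝ) * lam j := by
          -- Zero eigenvalues drop out. For this reason, and because of multiplicities, only `m = 0`
          -- is concluded, not `κ = 0`.
          refine Finset.sum_subset (Finset.filter_subset _ _) fun j _ hj => ?_
          have : lam j = 0 := le_antisymm (by simpa using hj) (hnonneg j)
          rw [this, mul_zero]

theorem freq_add {n : ℕ} (lam : Fin (n + 1) → ℝ) (μ ν μ' ν' : MI n) :
    freq lam (μ + μ') (ν + ν') = freq lam μ ν + freq lam μ' ν' := by
  rw [freq, freq, freq, ← Finset.sum_add_distrib]
  refine Finset.sum_congr rfl fun j _ => ?_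
  simp only [Pi.add_apply]
  push_cast
  ring

theorem freq_swap {n : ℕ} (lam : Fin (n + 1) → ℝ) (μ ν : MI n) :
    freq lam μ ν = -freq lam ν μ := by
  rw [freq, freq, ← Finset.sum_neg_distrib]
  exact Finset.sum_congr rfl fun j _ => by ring

/-- The level of an index in `𝐌` determines its first component. -/
theorem StandingAssumptions.fst_eq_of_level_eq {V : 𝓢(R3, ℝ)} {c : ℝ} {n : ℕ}
    {lam : Fin (n + 1) → ℝ} {Nj : Fin n → ℕ} (h : StandingAssumptions V c lam Nj) {p q : Idx n}
    (hp : p ∈ bigM lam c (bigN c Nj)) (hq : q ∈ bigM lam c (bigN c Nj))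
    (hpq : level lam p = level lam q) : p.1 = q.1 := by
  rw [mem_bigM] at hp hq
  obtain ⟨-, hp1, hp2, hp3⟩ := hp
  obtain ⟨-, hq1, hq2, hq3⟩ := hq
  rw [← sub_eq_zero]
  refine h.eq_zero_of_resonance
    (fun j => ((p.2.2 j : ℤ) - p.2.1 j) - ((q.2.2 j : ℤ) - q.2.1 j)) _ ?_ ?_ ?_
  -- Each triple has `|μ| ≤ N` and `|ν| ≤ N + 1`, so two of them use up exactly the allowed `4N +
  -- 2`.
  · have hle : ∀ j, |((p.2.2 j : ℤ) - p.2.1 j) - ((q.2.2 j : ℤ) - q.2.1 j)| ≤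
        (p.2.2 j + p.2.1 j + q.2.2 j + q.2.1 j : ℤ) := fun j => by
      rw [abs_le]; constructor <;> omega
    refine (Finset.sum_le_sum fun j _ => hle j).trans ?_
    simp only [Finset.sum_add_distrib, ← Nat.cast_sum]
    change (deg p.2.2 + deg p.2.1 + deg q.2.2 + deg q.2.1 : ℤ) ≤ _
    omega
  · rw [abs_le] at *
    constructor <;> omega
  · rw [← sub_eq_zero] at hpq
    rw [← hpq, level, level, freq, freq]
    push_cast
    rw [add_sub_add_comm, ← Finset.sum_sub_distrib]
    congr 1
    exact Finset.sum_congr rfl fun j _ => by ring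

/-! ### Monomials -/

theorem mono_add {n : ℕ} (z : Fin (n + 1) → ℂ) (μ ν μ' ν' : MI n) :
    mono z (μ + μ') (ν + ν') = mono z μ ν * mono z μ' ν' := by
  simp only [mono, Pi.add_apply, pow_add, Finset.prod_mul_distrib]
  ring

theorem conj_mono {n : ℕ} (z : Fin (n + 1) → ℂ) (μ ν : MI n) :
    conj (mono z μ ν) = mono z ν μ := by
  simp [mono, mul_comm]

theorem monoDiv_mul_conj {n : ℕ} (z : Fin (n + 1) → ℂ) (j : Fin (n + 1)) (α ν β : MI n) :
    monoDiv z j α ν β * conj (z j) = (ν j : ℂ) * mono z α (ν + β) := by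
  rw [monoDiv]
  rcases Nat.eq_zero_or_pos (ν j) with h0 | h0
  · simp [h0]
  -- As `ν_j > 0`, the truncated subtraction is exact here.
  · have hsplit : ν + β = (ν + β - Pi.single j 1) + Pi.single j 1 := by
      ext l
      rcases eq_or_ne l j with rfl | hl
      · simp only [Pi.add_apply, Pi.sub_apply, Pi.single_eq_same]; omega
      · simp [hl]
    have hone : mono z 0 (Pi.single j 1) = conj (z j) := by
      rw [mono, Finset.prod_eq_single j (f := fun l => conj (z l) ^ (Pi.single j 1 : MI n) l)]
      · simp
      · intro l _ hl; simp [hl]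
      · simp
    conv_rhs => rw [hsplit, ← add_zero α, mono_add, hone]
    ring

/-- Euler's identity weighted by `ν` alone, not by `ν + β`; this asymmetry is what produces the
weights `|ν|` and `|μ|` in the two resonant sums. -/
theorem sum_monoDiv_mul_conj {n : ℕ} (z : Fin (n + 1) → ℂ) (α ν β : MI n) :
    ∑ j, monoDiv z j α ν β * conj (z j) = (deg ν : ℂ) * mono z α (ν + β) := by
  simp only [monoDiv_mul_conj, ← Finset.sum_mul, deg, Nat.cast_sum]

theorem mono_smul {n : ℕ} (k : ℂ) (z : Fin (n + 1) → ℂ) (μ ν : MI n) :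
    mono (k • z) μ ν = k ^ deg μ * conj k ^ deg ν * mono z μ ν := by
  simp only [mono, Pi.smul_apply, smul_eq_mul, map_mul, mul_pow, Finset.prod_mul_distrib,
    Finset.prod_pow_eq_pow_sum, deg]
  ring

theorem differentiable_mono {n : ℕ} (μ ν : MI n) :
    Differentiable ℝ fun z : Fin (n + 1) → ℂ => mono z μ ν := by
  have hconj : Differentiable ℝ (fun w : ℂ => conj w) := Complex.conjCLE.differentiable
  unfold mono
  refine Differentiable.mul ?_ ?_
  · fun_prop
  · have hfac : ∀ j : Fin (n + 1), Differentiable ℝ fun z : Fin (n + 1) → ℂ => conj (z j) ^ ν j :=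
      fun j => (hconj.comp (differentiable_apply (𝕜 := ℝ) j)).fun_pow _
    fun_prop

/-! ### The function `Z_0` -/

theorem NormalForm.differentiable_Z0 {n : ℕ} {lam : Fin (n + 1) → ℝ} (Z : NormalForm lam) :
    Differentiable ℝ Z.Z0 := by
  unfold NormalForm.Z0 Finsupp.sum
  exact Differentiable.fun_sum fun p _ => (differentiable_mono _ _).const_mul _

theorem NormalForm.conj_Z0 {n : ℕ} {lam : Fin (n + 1) → ℝ} (Z : NormalForm lam)
    (z : Fin (n + 1) → ℂ) : conj (Z.Z0 z) = Z.Z0 z := by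
  have ha : ∀ p : MI n × MI n, Z.a p.swap = conj (Z.a p) := fun p => (Z.a_real p.1 p.2).symm
  rw [NormalForm.Z0, Finsupp.sum, map_sum]
  refine Finset.sum_nbij' Prod.swap Prod.swap ?_ ?_ ?_ ?_ ?_
  · intro p hp; simpa [ha] using hp
  · intro p hp; simpa [ha] using hp
  · intro p _; simp
  · intro p _; simp
  · intro p _
    simp [ha, conj_mono]

theorem NormalForm.Z0_smul {n : ℕ} {lam : Fin (n + 1) → ℝ} (Z : NormalForm lam) {k : ℂ}
    (hk : k * conj k = 1) (z : Fin (n + 1) → ℂ) : Z.Z0 (k • z) = Z.Z0 z := by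
  refine Finset.sum_congr rfl fun p hp => ?_
  have hdeg := (Z.a_resonant p.1 p.2 (Finsupp.mem_support_iff.mp hp)).2
  simp only [mono_smul, hdeg, ← mul_pow, hk, one_pow, one_mul]

/-- Infinitesimal gauge invariance: `Z_0` is constant along the orbit `e^{is} z`, whose velocity at
`s = 0` is `i z`. -/
theorem NormalForm.fderiv_Z0_I_smul {n : ℕ} {lam : Fin (n + 1) → ℝ} (Z : NormalForm lam)
    (z : Fin (n + 1) → ℂ) : fderiv ℝ Z.Z0 z (Complex.I • z) = 0 := by
  have hexp : HasDerivAt (fun s : ℝ => Complex.exp (s * Complex.I)) Complex.I 0 := by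
    have := ((hasDerivAt_id (0 : ℝ)).ofReal_comp.mul_const Complex.I).cexp
    simpa using this
  have hcurve : HasDerivAt (fun s : ℝ => Complex.exp (s * Complex.I) • z) (Complex.I • z) 0 :=
    hexp.smul_const z
  have hz : Complex.exp (((0 : ℝ) : ℂ) * Complex.I) • z = z := by simp
  have hd := (Z.differentiable_Z0 (Complex.exp (((0 : ℝ) : ℂ) * Complex.I) • z)).hasFDerivAt
  have hcomp := hd.comp_hasDerivAt (0 : ℝ) hcurve
  rw [hz] at hcomp
  have hconst : (Z.Z0 ∘ fun s : ℝ => Complex.exp (s * Complex.I) • z) = fun _ => Z.Z0 z := by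
    ext s
    refine Z.Z0_smul ?_ z
    rw [← Complex.exp_conj, ← Complex.exp_add]
    simp
  rw [hconst] at hcomp
  exact hcomp.unique (hasDerivAt_const _ _)

theorem NormalForm.conj_fderiv_Z0 {n : ℕ} {lam : Fin (n + 1) → ℝ} (Z : NormalForm lam)
    (z v : Fin (n + 1) → ℂ) : conj (fderiv ℝ Z.Z0 z v) = fderiv ℝ Z.Z0 z v := by
  have h1 : (Complex.conjCLE ∘ Z.Z0) = Z.Z0 := by
    ext w
    exact Z.conj_Z0 w
  have h2 := Complex.conjCLE.comp_fderiv (f := Z.Z0) (x := z)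
  rw [h1] at h2
  exact (congrArg (fun L => L v) h2).symm

/-- Euler's identity for the Wirtinger derivatives. -/
theorem sum_dbar_mul_conj {n : ℕ} (F : (Fin (n + 1) → ℂ) → ℂ) (z : Fin (n + 1) → ℂ) :
    ∑ j, dbar F j z * conj (z j) =
      (1 / 2) * (fderiv ℝ F z z + Complex.I * fderiv ℝ F z (Complex.I • z)) := by
  set L := fderiv ℝ F z
  have hdecomp : ∀ w : Fin (n + 1) → ℂ, L w =
      ∑ j, (((w j).re : ℂ) * L (Pi.single j 1) + ((w j).im : ℂ) * L (Pi.single j Complex.I)) := by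
    intro w
    have hw : w = ∑ j, ((w j).re • (Pi.single j 1 : Fin (n + 1) → ℂ)
        + (w j).im • (Pi.single j Complex.I : Fin (n + 1) → ℂ)) := by
      conv_lhs => rw [← Finset.univ_sum_single w]
      refine Finset.sum_congr rfl fun j _ => ?_
      rw [← Pi.single_smul, ← Pi.single_smul, ← Pi.single_add]
      congr 1
      simp [Complex.re_add_im]
    conv_lhs => rw [hw]
    simp [map_sum]
  rw [hdecomp z, hdecomp (Complex.I • z), Finset.mul_sum, ← Finset.sum_add_distrib, Finset.mul_sum]
  refine Finset.sum_congr rfl fun j _ => ?_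
  have hc : conj (z j) = (z j).re - (z j).im * Complex.I := by
    apply Complex.ext <;> simp
  rw [dbar, hc]
  simp only [Pi.smul_apply, smul_eq_mul, Complex.mul_re, Complex.mul_im, Complex.I_re,
    Complex.I_im, zero_mul, one_mul, zero_sub, zero_add]
  push_cast
  have hI := Complex.I_mul_I
  linear_combination (-(1 / 2) * (z j).im * L (Pi.single j Complex.I)) * hI

/-- `Z_0` conserves mass: gauge invariance kills the derivative along `i z`, and the radial
derivative that remains is real. -/
theorem NormalForm.sum_im_dbar_Z0 {n : ℕ} {lam : Fin (n + 1) → ℝ} (Z : NormalForm lam)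
    (z : Fin (n + 1) → ℂ) : ∑ j, (dbar Z.Z0 j z * conj (z j)).im = 0 := by
  rw [← Complex.im_sum, sum_dbar_mul_conj, Z.fderiv_Z0_I_smul, mul_zero, add_zero]
  have := Complex.conj_eq_iff_im.mp (Z.conj_fderiv_Z0 z z)
  simp [Complex.mul_im, this]

/-! ### The sets `M` and `M'` -/

/-- Minimality is symmetric under exchanging the two multi-indices. -/
theorem mem_Mset' {n : ℕ} {lam : Fin (n + 1) → ℝ} {c : ℝ} {N : ℕ} {p : Idx n} :
    p ∈ Mset' lam c N ↔ flip p ∈ Mset lam c N := by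
  simp only [Mset', Mset, minimalIdx, Finset.mem_filter, mem_bigM', flip]
  refine and_congr_right fun _ => ⟨fun h α β hm hα hβ => ?_, fun h α β hm hα hβ => ?_⟩
  · have := h β α hm hβ hα
    rw [Prod.ext_iff] at this ⊢
    exact this.symm
  · have := h β α hm hβ hα
    rw [Prod.ext_iff] at this ⊢
    exact this.symm

theorem Mset_subset {n : ℕ} {lam : Fin (n + 1) → ℝ} {c : ℝ} {N : ℕ} :
    Mset lam c N ⊆ bigM lam c N := by
  classical
  exact Finset.filter_subset _ _

theorem energy_flip {n : ℕ} (lam : Fin (n + 1) → ℝ) (p : Idx n) :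
    energy lam (flip p) = level lam p := by
  simp [energy, level, flip]

/-! ### Resonant terms as sums over pairs in `M` -/

/-- The term `ζ^μ ζ̄^ν conj (ζ^μ' ζ̄^ν') ⟨R⁺ conj Φ_q, Φ_p⟩`. -/
def interaction (V : 𝓢(R3, ℝ)) (c : ℝ) {n : ℕ} {lam : Fin (n + 1) → ℝ} (Z : NormalForm lam)
    (ζ : Fin (n + 1) → ℂ) (p q : Idx n) : ℂ :=
  mono ζ p.2.1 p.2.2 * conj (mono ζ q.2.1 q.2.2)
    * resPlus V c (level lam q) (conjS (Z.Φ q)) (Z.Φ p)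

open Classical in
/-- The pairs of indices in `M` with the same first component and the same level. -/
def resonantPairs {n : ℕ} (lam : Fin (n + 1) → ℝ) (c : ℝ) (N : ℕ) : Finset (Idx n × Idx n) :=
  (Mset lam c N ×ˢ Mset lam c N).filter fun pq =>
    pq.2.1 = pq.1.1 ∧ level lam pq.1 = level lam pq.2

-- Flipping the second index carries `M × M'` to `M × M` and the resonance condition to equality of
-- levels.
open Classical in
theorem sum_resonant_plus (V : 𝓢(R3, ℝ)) (c : ℝ) {n : ℕ} {lam : Fin (n + 1) → ℝ} (N : ℕ)
    (Z : NormalForm lam) (ζ : Fin (n + 1) → ℂ) :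
    (∑ pq ∈ (Mset lam c N ×ˢ Mset' lam c N).filter (fun pq => pq.2.1 = -pq.1.1 ∧
        freq lam (pq.1.2.1 + pq.2.2.1) (pq.1.2.2 + pq.2.2.2) = 0),
      (∑ j, monoDiv ζ j (pq.1.2.1 + pq.2.2.1) pq.1.2.2 pq.2.2.2 * conj (ζ j))
        * resPlus V c (energy lam pq.2) (conjS (Z.Φ (pq.1.1, pq.2.2.2, pq.2.2.1))) (Z.Φ pq.1)) =
      ∑ pq ∈ resonantPairs lam c N, (deg pq.1.2.2 : ℂ) * interaction V c Z ζ pq.1 pq.2 := by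
  refine Finset.sum_nbij' (fun pq => (pq.1, flip pq.2)) (fun pq => (pq.1, flip pq.2)) ?_ ?_ ?_ ?_ ?_
  · rintro ⟨p, q⟩ hpq
    simp only [resonantPairs, Finset.mem_filter, Finset.mem_product, mem_Mset', freq_add] at hpq ⊢
    obtain ⟨⟨hp, hq⟩, h1, h2⟩ := hpq
    refine ⟨⟨hp, hq⟩, by simp [flip, h1], ?_⟩
    rw [freq_swap lam p.2.1] at h2
    simp only [level, flip, h1]
    push_cast
    linarith
  · rintro ⟨p, q⟩ hpq
    simp only [resonantPairs, Finset.mem_filter, Finset.mem_product, mem_Mset', freq_add,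
      flip_flip] at hpq ⊢
    obtain ⟨⟨hp, hq⟩, h1, h2⟩ := hpq
    refine ⟨⟨hp, hq⟩, by simp [flip, h1], ?_⟩
    rw [freq_swap lam p.2.1]
    simp only [level, h1] at h2
    simp only [flip]
    linarith
  · rintro ⟨p, q⟩ _; simp [flip_flip]
  · rintro ⟨p, q⟩ _; simp [flip_flip]
  · rintro ⟨p, q⟩ hpq
    simp only [Finset.mem_filter] at hpq
    have h1 : (p.1, q.2.2, q.2.1) = flip q := by simp [flip, hpq.2.1]
    have h2 : energy lam q = level lam (flip q) := by rw [← energy_flip, flip_flip]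
    simp only [h1, h2, sum_monoDiv_mul_conj, mono_add, interaction, conj_mono]
    simp only [flip]
    ring

-- Here both indices are flipped, so the weight `|ν|` on `M'` becomes `|μ|` on `M`, while `Ψ = conj
-- Φ` turns the `R⁻` term into the conjugate of the `R⁺` term.
open Classical in
theorem sum_resonant_minus (V : 𝓢(R3, ℝ)) (c : ℝ) {n : ℕ} {lam : Fin (n + 1) → ℝ} (N : ℕ)
    (Z : NormalForm lam) (ζ : Fin (n + 1) → ℂ) :
    (∑ pq ∈ (Mset' lam c N ×ˢ Mset' lam c N).filter (fun pq => pq.2.1 = pq.1.1 ∧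
        freq lam pq.1.2.1 pq.1.2.2 = freq lam pq.2.2.1 pq.2.2.2),
      (∑ j, monoDiv ζ j (pq.1.2.1 + pq.2.2.2) pq.1.2.2 pq.2.2.1 * conj (ζ j))
        * resMinus V c (energy lam pq.2) (conjS (Z.Ψ pq.2)) (Z.Ψ pq.1)) =
      ∑ pq ∈ resonantPairs lam c N, (deg pq.1.2.1 : ℂ) * conj (interaction V c Z ζ pq.1 pq.2) := by
  have hΨ : ∀ p, Z.Ψ p = conjS (Z.Φ (flip p)) := fun p => Z.Ψ_eq p.1 p.2.1 p.2.2
  refine Finset.sum_nbij' (fun pq => (flip pq.1, flip pq.2)) (fun pq => (flip pq.1, flip pq.2))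
    ?_ ?_ ?_ ?_ ?_
  · rintro ⟨p, q⟩ hpq
    simp only [resonantPairs, Finset.mem_filter, Finset.mem_product, mem_Mset'] at hpq ⊢
    obtain ⟨⟨hp, hq⟩, h1, h2⟩ := hpq
    refine ⟨⟨hp, hq⟩, by simp [flip, h1], ?_⟩
    simp [level, flip, h1, h2]
  · rintro ⟨p, q⟩ hpq
    simp only [resonantPairs, Finset.mem_filter, Finset.mem_product, mem_Mset', flip_flip] at hpq ⊢
    obtain ⟨⟨hp, hq⟩, h1, h2⟩ := hpq
    refine ⟨⟨hp, hq⟩, by simp [flip, h1], ?_⟩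
    simpa [level, flip, h1] using h2
  · rintro ⟨p, q⟩ _; simp [flip_flip]
  · rintro ⟨p, q⟩ _; simp [flip_flip]
  · rintro ⟨p, q⟩ hpq
    have h2 : energy lam q = level lam (flip q) := by rw [← energy_flip, flip_flip]
    simp only [h2, hΨ, resMinus_conjS, sum_monoDiv_mul_conj, interaction, map_mul]
    simp only [mono_add, conj_mono, flip]
    ring

/-- The resonant terms change the mass by the interactions of the resonant pairs. -/
theorem sum_im_resonantTerms (V : 𝓢(R3, ℝ)) (c : ℝ) {n : ℕ} {lam : Fin (n + 1) → ℝ} (N : ℕ)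
    (Z : NormalForm lam) (ζ : Fin (n + 1) → ℂ) :
    ∑ j, (resonantTerms V c N Z ζ j * conj (ζ j)).im =
      -∑ pq ∈ resonantPairs lam c N, (interaction V c Z ζ pq.1 pq.2).im := by
  have hsum : ∑ j, resonantTerms V c N Z ζ j * conj (ζ j) =
      -(∑ pq ∈ resonantPairs lam c N, (deg pq.1.2.2 : ℂ) * interaction V c Z ζ pq.1 pq.2)
      - ∑ pq ∈ resonantPairs lam c N,
          (deg pq.1.2.1 : ℂ) * conj (interaction V c Z ζ pq.1 pq.2) := by
    rw [← sum_resonant_plus, ← sum_resonant_minus]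
    simp only [resonantTerms, sub_mul, neg_mul, Finset.sum_mul, Finset.sum_sub_distrib,
      Finset.sum_neg_distrib]
    refine congrArg₂ (fun a b : ℂ => -a - b) ?_ ?_
    · rw [Finset.sum_comm]
      exact Finset.sum_congr rfl fun pq _ => Finset.sum_congr rfl fun j _ => by ring
    · rw [Finset.sum_comm]
      exact Finset.sum_congr rfl fun pq _ => Finset.sum_congr rfl fun j _ => by ring
  rw [← Complex.im_sum, hsum, ← Finset.sum_neg_distrib, ← Finset.sum_sub_distrib,
    ← Finset.sum_neg_distrib, Complex.im_sum]
  refine Finset.sum_congr rfl fun pq hpq => ?_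
  have hp := Mset_subset (Finset.mem_product.mp (Finset.mem_filter.mp hpq).1).1
  -- With `|ν| = |μ| + 1`, the imaginary part of `|ν| I + |μ| conj I` is that of `I`.
  have hdeg : ((deg pq.1.2.1 : ℝ) + 1) = deg pq.1.2.2 := by
    exact_mod_cast ((mem_bigM _ _ _ _).mp hp).2.1
  simp only [Complex.sub_im, Complex.neg_im, Complex.mul_im, Complex.natCast_re,
    Complex.natCast_im, Complex.conj_im, Complex.conj_re, ← hdeg]
  ring

/-- Equal levels already force equal first components, so each level contributes a full square `M_w
× M_w`, and bilinearity sums it up. -/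
theorem StandingAssumptions.sum_interaction {V : 𝓢(R3, ℝ)} {c : ℝ} {n : ℕ}
    {lam : Fin (n + 1) → ℝ} {Nj : Fin n → ℕ} (h : StandingAssumptions V c lam Nj)
    (Z : NormalForm lam) (ζ : Fin (n + 1) → ℂ) :
    ∑ pq ∈ resonantPairs lam c (bigN c Nj), interaction V c Z ζ pq.1 pq.2 =
      ∑ w ∈ Xset lam c (bigN c Nj), resPlus V c w (conjS (PhiW c (bigN c Nj) Z ζ w))
        (PhiW c (bigN c Nj) Z ζ w) := by
  classical
  set N := bigN c Nj
  have hpairs : ∀ pq ∈ resonantPairs lam c N, level lam pq.1 ∈ Xset lam c N := by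
    intro pq hpq
    exact Finset.mem_image_of_mem _ (Finset.mem_product.mp (Finset.mem_filter.mp hpq).1).1
  rw [← Finset.sum_fiberwise_of_maps_to hpairs]
  refine Finset.sum_congr rfl fun w _ => ?_
  have hfiber : (resonantPairs lam c N).filter (fun pq => level lam pq.1 = w) =
      Mw lam c N w ×ˢ Mw lam c N w := by
    ext ⟨p, q⟩
    simp only [resonantPairs, Mw, Finset.mem_filter, Finset.mem_product]
    constructor
    · rintro ⟨⟨⟨hp, hq⟩, -, h2⟩, h3⟩
      exact ⟨⟨hp, h3⟩, hq, h2 ▸ h3⟩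
    · rintro ⟨⟨hp, h3⟩, hq, h4⟩
      exact ⟨⟨⟨hp, hq⟩, h.fst_eq_of_level_eq (Mset_subset hq) (Mset_subset hp) (h4.trans h3.symm),
        h3.trans h4.symm⟩, h3⟩
  rw [hfiber, Finset.sum_product_right, PhiW, conjS_sum_smul, resPlus_sum_sum]
  refine Finset.sum_congr rfl fun q hq => Finset.sum_congr rfl fun p _ => ?_
  rw [interaction, (Finset.mem_filter.mp hq).2]
  ring

/-! ### The modified variables -/

/-- Differentiability is all that the balance needs to know about the correction. -/
theorem differentiable_correction (V : 𝓢(R3, ℝ)) (c : ℝ) {n : ℕ} {lam : Fin (n + 1) → ℝ} (N : ℕ)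
    (Z : NormalForm lam) {z : ℝ → Fin (n + 1) → ℂ} {t : ℝ} (hz : DifferentiableAt ℝ z t)
    (j : Fin (n + 1)) : DifferentiableAt ℝ (fun s => correction V c N Z s (z s) j) t := by
  have hmono : ∀ α ν β : MI n, DifferentiableAt ℝ (fun s => monoDiv (z s) j α ν β) t := by
    intro α ν β
    exact (((differentiable_mono α (ν + β - Pi.single j 1)) (z t)).comp t hz).const_mul _
  have hexp : ∀ k : ℂ, DifferentiableAt ℝ (fun s : ℝ => Complex.exp (Complex.I * k * s)) t := by
    intro k
    fun_prop
  unfold correction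
  refine DifferentiableAt.add ?_ ?_
  all_goals
    refine DifferentiableAt.fun_sum fun pq _ => ?_
    exact (((hexp _).mul (hmono _ _ _)).mul_const _).div_const _

end

end FermiGoldenRule

/-! ### The mass balance -/

open FermiGoldenRule in
theorem lemma4p5 (V : 𝓢(R3, ℝ)) (c : ℝ) (n : ℕ) (lam : Fin (n + 1) → ℝ) (Nj : Fin n → ℕ)
    (h : StandingAssumptions V c lam Nj) (Z : NormalForm lam)
    (z : ℝ → Fin (n + 1) → ℂ) (t : ℝ) (hz : DifferentiableAt ℝ z t)
    (ζ : ℝ → Fin (n + 1) → ℂ) (hζ : ζ = modifiedVar V c (bigN c Nj) Z z) :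
    (∀ j, DifferentiableAt ℝ (fun s => ζ s j) t) ∧
    ((∑ j, (1 / 2) * deriv (fun s => ‖ζ s j‖ ^ 2) t : ℝ) : ℂ)
        + Real.pi * ∑ w ∈ Xset lam c (bigN c Nj),
          deltaPair V c w (conjS (PhiW c (bigN c Nj) Z (ζ t) w)) (PhiW c (bigN c Nj) Z (ζ t) w)
      = ((∑ j, (remainder V c (bigN c Nj) Z ζ t j * conj (ζ t j)).im : ℝ) : ℂ) := by
  have hdiff : ∀ j, DifferentiableAt ℝ (fun s => ζ s j) t := by
    intro j
    subst hζ
    exact (differentiableAt_pi.mp hz j).sub (differentiable_correction V c _ Z hz j)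
  refine ⟨hdiff, ?_⟩
  -- `½ ∂_t |ζ_j|² = Re (ζ_j' conj ζ_j) = Im (i ζ_j' conj ζ_j)`.
  have hmass : ∀ j, (1 / 2) * deriv (fun s => ‖ζ s j‖ ^ 2) t =
      (Complex.I * deriv (fun s => ζ s j) t * conj (ζ t j)).im := by
    intro j
    rw [((hdiff j).hasDerivAt.norm_sq).deriv, Complex.inner]
    simp only [Complex.mul_re, Complex.mul_im, Complex.I_re, Complex.I_im, Complex.conj_re,
      Complex.conj_im]
    ring
  have hdelta : (Real.pi : ℂ) * ∑ w ∈ Xset lam c (bigN c Nj), deltaPair V c w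
      (conjS (PhiW c (bigN c Nj) Z (ζ t) w)) (PhiW c (bigN c Nj) Z (ζ t) w) =
      ((-∑ j, (resonantTerms V c (bigN c Nj) Z (ζ t) j * conj (ζ t j)).im : ℝ) : ℂ) := by
    rw [sum_im_resonantTerms, neg_neg, ← Complex.im_sum, h.sum_interaction, Complex.im_sum,
      Finset.mul_sum]
    simp only [pi_mul_deltaPair_conjS]
    push_cast
    rfl
  have hlam : ∀ j, ((lam j : ℂ) * ζ t j * conj (ζ t j)).im = 0 := by
    intro j
    rw [mul_assoc, Complex.mul_conj, ← Complex.ofReal_mul, Complex.ofReal_im]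
  rw [hdelta, ← Complex.ofReal_add]
  congr 1
  simp only [hmass, remainder, sub_mul, Complex.sub_im, Finset.sum_sub_distrib,
    Z.sum_im_dbar_Z0, hlam, Finset.sum_const_zero]
  ring
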